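/- **Theorem (fusion rules).** Let $m=(m_1,\dots,m_n)$ be positive integers, $\mathbb Z_m=\prod_i\mathbb Z/m_i$, let $\xi_i\in\mathbb C$ be a primitive $m_i$-th root of unity, and write $\xi^{v\cdot w}=\prod_i\xi_i^{v_iw_i}$ for $v,w\in\mathbb Z_m$. Let $d_1,\dots,d_t,u_1,\dots,u_t\in\mathbb Z_m$ satisfy $\xi^{u_k\cdot d_k}=-1$ for all $k$ and $\xi^{u_k\cdot d_l}\,\xi^{u_l\cdot d_k}=1$ for $k\ne l$. Let $H=H(m,t,d,u)$ be the Nenciu type Hopf algebra over $\mathbb C$ with generators $K_1,\dots,K_n,X_1,\dots,X_t$ and relations $$K_iK_j=K_jK_i,\quad K_i^{m_i}=1,\quad K_iX_k=\xi_i^{(d_k)_i}X_kK_i,\quad X_kX_l=\xi^{u_k\cdot d_l}X_lX_k\ (k\neq l),\quad X_k^2=0,$$ with $\Delta(K_i)=K_i\otimes K_i$ and $\Delta(X_k)=1\otimes X_k+X_k\otimes L_k$, where $L_k=\prod_iK_i^{(u_k)_i}$. For $p\in\mathbb Z_m$ let $\omega_p=\prod_i\frac1{m_i}\sum_{j=0}^{m_i-1}\xi_i^{jp_i}K_i^j$,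 so that $K_i\omega_p=\xi_i^{-p_i}\omega_p$. For $r\in\mathbb Z_2^t$ let $X^r=X_1^{r_1}\cdots X_t^{r_t}$, and let $V^r_p=H\,X^r\omega_p$ be the left $H$-submodule of the regular module generated by $X^r\omega_p$ (it is indecomposable). Let $r,s\in\mathbb Z_2^t$ and $p,q\in\mathbb Z_m$. Let $r\cdot s$ be the componentwise product and let $a,b,c\in\mathbb Z_m$ be the commutation exponents of the grouplikes past $X^r$, $X^s$ and $X^{r\cdot s}$: for all $i$, $$K_iX^r=\xi_i^{a_i}X^rK_i,\qquad K_iX^s=\xi_i^{b_i}X^sK_i,\qquad K_iX^{r\cdot s}=\xi_i^{c_i}X^{r\cdot s}K_i .$$ For $o\in\mathbb Z_2^t$ let $\mathcal L_o$ be the multiset of the elements $\sum_ke_kd_k\in\mathbb Z_m$, one for each $e\in\{0,1\}^t$ with $e_k\le o_k$ for all $k$. Then, with $H$ acting on the tensor product over $\mathbb C$ through $\Delta$, there is an isomorphism of $H$-modules $$V^r_p\otimes V^s_q\;\cong\;\bigoplus_{l\in\mathcal L_{(1,\dots,1)-(r+s)-r\cdot s}}V^{\,r\cdot s}_{\,p+q-a-b+c-l},$$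 where $(1,\dots,1)-(r+s)-r\cdot s$ is computed in $\mathbb Z_2^t$. -/

import Mathlib

open scoped TensorProduct DirectSum

noncomputable section

/-- The data `(m, t, d, u)` of a Nenciu type Hopf algebra with `n` grouplike generators
`K_i` (of order `m i`) and `t` nilpotent generators `X_k`. -/
structure NenciuData (n t : ℕ) where
  /-- orders of the grouplike generators -/
  m : Fin n → ℕ
  m_ne : ∀ i, NeZero (m i)
  /-- the chosen primitive roots of unity -/
  ξ : Fin n → ℂ
  prim : ∀ i, IsPrimitiveRoot (ξ i) (m i)
  /-- commutation exponents: `K_i X_k = ξ_i ^ (d k i) X_k K_i` -/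
  d : Fin t → ∀ i, ZMod (m i)
  /-- coproduct exponents: `Δ X_k = 1 ⊗ X_k + X_k ⊗ K ^ (u k)` -/
  u : Fin t → ∀ i, ZMod (m i)
  /-- `ξ ^ (u_k · d_k) = -1` -/
  diag : ∀ k, ∏ i, ξ i ^ ((u k i).val * (d k i).val) = -1
  /-- `ξ ^ (u_k · d_l) ξ ^ (u_l · d_k) = 1` for `k ≠ l` -/
  offdiag : ∀ k l, k ≠ l →
    (∏ i, ξ i ^ ((u k i).val * (d l i).val)) * (∏ i, ξ i ^ ((u l i).val * (d k i).val)) = 1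

attribute [instance] NenciuData.m_ne

/-- A product over `Fin n`, multiplied in increasing order of the index. -/
def orderedProd {M : Type*} [Monoid M] {n : ℕ} (f : Fin n → M) : M := (List.ofFn f).prod

theorem map_orderedProd {M N F : Type*} [Monoid M] [Monoid N] [FunLike F M N]
    [MonoidHomClass F M N] (φ : F) {n : ℕ} (f : Fin n → M) :
    φ (orderedProd f) = orderedProd (fun i => φ (f i)) := by
  simp only [orderedProd, map_list_prod, List.map_ofFn]
  rfl

namespace NenciuData

variable {n t : ℕ} (D : NenciuData n t)

/-- The group `ℤ_m = ∏ ℤ / m_i`. -/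
abbrev Wt : Type := ∀ i : Fin n, ZMod (D.m i)

/-- `ξ ^ (v · w) = ∏ i, ξ_i ^ (v_i w_i)` -/
def pair (v w : D.Wt) : ℂ := ∏ i, D.ξ i ^ ((v i).val * (w i).val)

/-- The free algebra on the symbols `K_i` and `X_k`. -/
abbrev Free (n t : ℕ) : Type := FreeAlgebra ℂ (Fin n ⊕ Fin t)

/-- the symbol `K_i` -/
abbrev fK (i : Fin n) : Free n t := FreeAlgebra.ι ℂ (Sum.inl i)

/-- the symbol `X_k` -/
abbrev fX (k : Fin t) : Free n t := FreeAlgebra.ι ℂ (Sum.inr k)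

/-- The defining relations. -/
inductive Rel : Free n t → Free n t → Prop
  | KK (i j : Fin n) : Rel (fK i * fK j) (fK j * fK i)
  | Kpow (i : Fin n) : Rel (fK i ^ D.m i) 1
  | KX (i : Fin n) (k : Fin t) : Rel (fK i * fX k) (D.ξ i ^ (D.d k i).val • (fX k * fK i))
  | XX (k l : Fin t) : k ≠ l → Rel (fX k * fX l) (D.pair (D.u k) (D.d l) • (fX l * fX k))
  | Xsq (k : Fin t) : Rel (fX k ^ 2) 0

/-- The algebra `H(m, t, d, u)` by generators and relations. -/
def Alg : Type := RingQuot D.Rel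

instance : Ring D.Alg := inferInstanceAs (Ring (RingQuot D.Rel))
instance : Algebra ℂ D.Alg := inferInstanceAs (Algebra ℂ (RingQuot D.Rel))

/-- the quotient map -/
def quot : Free n t →ₐ[ℂ] D.Alg := RingQuot.mkAlgHom ℂ D.Rel

/-- the grouplike generator `K_i` -/
def K (i : Fin n) : D.Alg := D.quot (fK i)

/-- the nilpotent generator `X_k` -/
def X (k : Fin t) : D.Alg := D.quot (fX k)

/-- `K ^ v = ∏ i, K_i ^ (v_i)` -/
def Kmon (v : D.Wt) : D.Alg := orderedProd fun i => D.K i ^ (v i).val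

/-- the grouplike element `L_k = K ^ (u_k)` -/
def L (k : Fin t) : D.Alg := D.Kmon (D.u k)

/-- `X ^ r = X_1 ^ (r_1) ⋯ X_t ^ (r_t)` -/
def Xmon (r : Fin t → ZMod 2) : D.Alg := orderedProd fun k => D.X k ^ (r k).val

theorem quot_rel {x y : Free n t} (h : D.Rel x y) : D.quot x = D.quot y :=
  RingQuot.mkAlgHom_rel ℂ h

theorem K_comm (i j : Fin n) : D.K i * D.K j = D.K j * D.K i := by
  simpa [K] using D.quot_rel (Rel.KK i j)

theorem K_pow (i : Fin n) : D.K i ^ D.m i = 1 := by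
  simpa [K] using D.quot_rel (Rel.Kpow i)

theorem K_X (i : Fin n) (k : Fin t) :
    D.K i * D.X k = D.ξ i ^ (D.d k i).val • (D.X k * D.K i) := by
  simpa [K, X] using D.quot_rel (Rel.KX i k)

theorem X_X (k l : Fin t) (h : k ≠ l) :
    D.X k * D.X l = D.pair (D.u k) (D.d l) • (D.X l * D.X k) := by
  simpa [X] using D.quot_rel (Rel.XX k l h)

theorem X_sq (k : Fin t) : D.X k ^ 2 = 0 := by
  simpa [X] using D.quot_rel (Rel.Xsq k)

/-- The universal property of the presentation. -/
def lift {B : Type*} [Ring B] [Algebra ℂ B] (f : Fin n → B) (g : Fin t → B)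
    (hKK : ∀ i j, f i * f j = f j * f i) (hKpow : ∀ i, f i ^ D.m i = 1)
    (hKX : ∀ i k, f i * g k = D.ξ i ^ (D.d k i).val • (g k * f i))
    (hXX : ∀ k l, k ≠ l → g k * g l = D.pair (D.u k) (D.d l) • (g l * g k))
    (hXsq : ∀ k, g k ^ 2 = 0) : D.Alg →ₐ[ℂ] B :=
  RingQuot.liftAlgHom ℂ ⟨FreeAlgebra.lift ℂ (Sum.elim f g), by
    intro x y h
    induction h with
    | KK i j => simpa using hKK i j
    | Kpow i => simpa using hKpow i
    | KX i k => simpa using hKX i k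
    | XX k l h => simpa using hXX k l h
    | Xsq k => simpa using hXsq k⟩

section lift
variable {B : Type*} [Ring B] [Algebra ℂ B] (f : Fin n → B) (g : Fin t → B)
    (hKK : ∀ i j, f i * f j = f j * f i) (hKpow : ∀ i, f i ^ D.m i = 1)
    (hKX : ∀ i k, f i * g k = D.ξ i ^ (D.d k i).val • (g k * f i))
    (hXX : ∀ k l, k ≠ l → g k * g l = D.pair (D.u k) (D.d l) • (g l * g k))
    (hXsq : ∀ k, g k ^ 2 = 0)

@[simp] theorem lift_K (i : Fin n) : D.lift f g hKK hKpow hKX hXX hXsq (D.K i) = f i := by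
  simp only [lift, K, quot]
  erw [RingQuot.liftAlgHom_mkAlgHom_apply]
  simp

@[simp] theorem lift_X (k : Fin t) : D.lift f g hKK hKpow hKX hXX hXsq (D.X k) = g k := by
  simp only [lift, X, quot]
  erw [RingQuot.liftAlgHom_mkAlgHom_apply]
  simp

end lift

theorem algHom_ext {B : Type*} [Ring B] [Algebra ℂ B] {φ ψ : D.Alg →ₐ[ℂ] B}
    (hK : ∀ i, φ (D.K i) = ψ (D.K i)) (hX : ∀ k, φ (D.X k) = ψ (D.X k)) : φ = ψ := by
  apply RingQuot.ringQuot_ext'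
  apply FreeAlgebra.hom_ext
  funext x
  cases x with
  | inl i => exact hK i
  | inr k => exact hX k

theorem orderedProd_comm {M : Type*} [Monoid M] {N : ℕ} (f : Fin N → M) (x : M)
    (h : ∀ i, x * f i = f i * x) : x * orderedProd f = orderedProd f * x := by
  have : Commute x (List.ofFn f).prod := by
    apply Commute.list_prod_right
    intro y hy
    obtain ⟨i, rfl⟩ := (List.mem_ofFn' f y).1 hy
    exact h i
  exact this

theorem orderedProd_smul_comm {B : Type*} [Ring B] [Algebra ℂ B] (x : B) :
    ∀ {N : ℕ} (f : Fin N → B) (c : Fin N → ℂ),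
    (∀ i, f i * x = c i • (x * f i)) → orderedProd f * x = (∏ i, c i) • (x * orderedProd f)
  | 0, f, c, _ => by simp [orderedProd]
  | N + 1, f, c, h => by
    have ih := orderedProd_smul_comm x (fun i => f i.succ) (fun i => c i.succ)
      (fun i => h i.succ)
    have e : orderedProd f = f 0 * orderedProd (fun i : Fin N => f i.succ) := by
      simp [orderedProd, List.ofFn_succ]
    rw [e, mul_assoc, ih, mul_smul_comm, ← mul_assoc, h 0, Fin.prod_univ_succ, smul_mul_assoc,
      smul_smul, mul_comm (c 0), mul_assoc]

theorem pow_smul_comm {B : Type*} [Ring B] [Algebra ℂ B] {k x : B} {c : ℂ}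
    (h : k * x = c • (x * k)) (N : ℕ) : k ^ N * x = c ^ N • (x * k ^ N) := by
  induction N with
  | zero => simp
  | succ N ih =>
    rw [pow_succ, mul_assoc, h, mul_smul_comm, ← mul_assoc, ih, smul_mul_assoc, smul_smul,
      mul_assoc, ← pow_succ, ← pow_succ']

theorem L_X (k l : Fin t) :
    D.L k * D.X l = D.pair (D.u k) (D.d l) • (D.X l * D.L k) := by
  refine orderedProd_smul_comm (D.X l) _
    (fun i => D.ξ i ^ ((D.u k i).val * (D.d l i).val)) (fun i => ?_)
  rw [pow_smul_comm (D.K_X i l), ← pow_mul, mul_comm (D.d l i).val]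

theorem K_Kmon (i : Fin n) (v : D.Wt) : D.K i * D.Kmon v = D.Kmon v * D.K i :=
  orderedProd_comm _ _ fun j =>
    ((show Commute (D.K i) (D.K j) from D.K_comm i j).pow_right _).eq

theorem L_L (k l : Fin t) : D.L k * D.L l = D.L l * D.L k :=
  orderedProd_comm _ _ fun j =>
    ((show Commute (D.K j) (D.L k) from D.K_Kmon j _).symm.pow_right _).eq

/-- `K_i ⊗ K_i` -/
abbrev KΔ (i : Fin n) : D.Alg ⊗[ℂ] D.Alg := D.K i ⊗ₜ[ℂ] D.K i

/-- `1 ⊗ X_k + X_k ⊗ L_k` -/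
abbrev XΔ (k : Fin t) : D.Alg ⊗[ℂ] D.Alg := 1 ⊗ₜ[ℂ] D.X k + D.X k ⊗ₜ[ℂ] D.L k

theorem KΔ_comm (i j : Fin n) : D.KΔ i * D.KΔ j = D.KΔ j * D.KΔ i := by
  simp only [Algebra.TensorProduct.tmul_mul_tmul, D.K_comm i j]

theorem KΔ_pow (i : Fin n) : D.KΔ i ^ D.m i = 1 := by
  simp only [Algebra.TensorProduct.tmul_pow, D.K_pow, Algebra.TensorProduct.one_def]

theorem KΔ_XΔ (i : Fin n) (k : Fin t) :
    D.KΔ i * D.XΔ k = D.ξ i ^ (D.d k i).val • (D.XΔ k * D.KΔ i) := by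
  simp only [mul_add, add_mul, Algebra.TensorProduct.tmul_mul_tmul, D.K_X, one_mul, mul_one,
    smul_add, TensorProduct.tmul_smul, TensorProduct.smul_tmul', L, D.K_Kmon]

theorem XΔ_XΔ (k l : Fin t) (h : k ≠ l) :
    D.XΔ k * D.XΔ l = D.pair (D.u k) (D.d l) • (D.XΔ l * D.XΔ k) := by
  have h1 : D.pair (D.u k) (D.d l) * D.pair (D.u l) (D.d k) = 1 := D.offdiag k l h
  simp only [mul_add, add_mul, Algebra.TensorProduct.tmul_mul_tmul, one_mul, mul_one, smul_add]
  rw [D.X_X k l h, D.L_X k l, D.L_X l k, D.L_L k l]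
  simp only [TensorProduct.tmul_smul, ← TensorProduct.smul_tmul', smul_smul, h1, one_smul]
  abel

theorem XΔ_sq (k : Fin t) : D.XΔ k ^ 2 = 0 := by
  have h1 : D.pair (D.u k) (D.d k) = -1 := D.diag k
  have h2 : D.X k * D.X k = 0 := by rw [← pow_two]; exact D.X_sq k
  have h3 : ∀ z : D.Alg ⊗[ℂ] D.Alg, (-1 : ℂ) • z + z = 0 := fun z => by
    rw [neg_smul, one_smul, neg_add_cancel]
  rw [pow_two]
  simp only [mul_add, add_mul, Algebra.TensorProduct.tmul_mul_tmul, one_mul, mul_one]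
  rw [D.L_X k k, h1, h2, TensorProduct.tmul_smul, TensorProduct.tmul_zero,
    TensorProduct.zero_tmul, add_zero, zero_add]
  exact h3 _

/-- The comultiplication: `Δ K_i = K_i ⊗ K_i`, `Δ X_k = 1 ⊗ X_k + X_k ⊗ L_k`. -/
def comulHom : D.Alg →ₐ[ℂ] D.Alg ⊗[ℂ] D.Alg :=
  D.lift D.KΔ D.XΔ D.KΔ_comm D.KΔ_pow D.KΔ_XΔ D.XΔ_XΔ D.XΔ_sq

/-- The counit: `ε K_i = 1`, `ε X_k = 0`. -/
def counitHom : D.Alg →ₐ[ℂ] ℂ :=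
  D.lift (fun _ => 1) (fun _ => 0) (by simp) (by simp) (by simp) (by simp) (by simp)

@[simp] theorem comulHom_K (i : Fin n) : D.comulHom (D.K i) = D.K i ⊗ₜ[ℂ] D.K i := by
  rw [comulHom, lift_K]

@[simp] theorem comulHom_X (k : Fin t) :
    D.comulHom (D.X k) = 1 ⊗ₜ[ℂ] D.X k + D.X k ⊗ₜ[ℂ] D.L k := by
  rw [comulHom, lift_X]

@[simp] theorem counitHom_K (i : Fin n) : D.counitHom (D.K i) = 1 := by simp [counitHom]

@[simp] theorem counitHom_X (k : Fin t) : D.counitHom (D.X k) = 0 := by simp [counitHom]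

theorem orderedProd_tmul {A : Type*} [Ring A] [Algebra ℂ A] : ∀ {N : ℕ} (f : Fin N → A),
    orderedProd (fun i => f i ⊗ₜ[ℂ] f i) = orderedProd f ⊗ₜ[ℂ] orderedProd f
  | 0, f => by simp [orderedProd, Algebra.TensorProduct.one_def]
  | N + 1, f => by
    have ih := orderedProd_tmul (fun i : Fin N => f i.succ)
    simp only [orderedProd, List.ofFn_succ, List.prod_cons] at ih ⊢
    rw [ih, Algebra.TensorProduct.tmul_mul_tmul]

@[simp] theorem comulHom_L (k : Fin t) : D.comulHom (D.L k) = D.L k ⊗ₜ[ℂ] D.L k := by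
  simp only [L, Kmon, map_orderedProd, map_pow, comulHom_K, Algebra.TensorProduct.tmul_pow]
  exact orderedProd_tmul _

@[simp] theorem counitHom_L (k : Fin t) : D.counitHom (D.L k) = 1 := by
  rw [L, Kmon, map_orderedProd]
  simp [orderedProd]

instance : Bialgebra ℂ D.Alg :=
  Bialgebra.ofAlgHom D.comulHom D.counitHom
    (by
      apply D.algHom_ext
      · intro i; simp
      · intro k
        simp [TensorProduct.tmul_add, TensorProduct.add_tmul, Algebra.TensorProduct.one_def,
          add_assoc])
    (by
      apply D.algHom_ext
      · intro i; simp
      · intro k; simp)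
    (by
      apply D.algHom_ext
      · intro i; simp
      · intro k; simp)

/-- `φ^i_p = (1 / m_i) ∑_{j < m_i} ξ_i ^ (j p) K_i ^ j`, the idempotent of `ℂ[K_i]` on which `K_i`
acts by `ξ_i ^ (-p)`. -/
def phi (i : Fin n) (p : ZMod (D.m i)) : D.Alg :=
  (1 / (D.m i : ℂ)) • ∑ j ∈ Finset.range (D.m i), D.ξ i ^ (j * p.val) • D.K i ^ j

/-- `ω_p = ∏ i, φ^i_{p_i}` -/
def omega (p : D.Wt) : D.Alg := orderedProd fun i => D.phi i (p i)

/-- `V^r_p`: the submodule of the left regular module `H` (in fact of `P_p = H ω_p`)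
generated by `X ^ r ω_p`. -/
def V (r : Fin t → ZMod 2) (p : D.Wt) : Submodule D.Alg D.Alg :=
  Submodule.span D.Alg {D.Xmon r * D.omega p}

/-- `a` is the tuple of commutation exponents of the grouplikes past `X ^ r`:
`K_i X ^ r = ξ_i ^ (a_i) X ^ r K_i` for all `i`. -/
def IsCommExp (r : Fin t → ZMod 2) (a : D.Wt) : Prop :=
  ∀ i, D.K i * D.Xmon r = D.ξ i ^ (a i).val • (D.Xmon r * D.K i)

/-- The tuples `e` selecting a subset of the generators selected by `o`. They index the elements
of `ℒ_o`, counted with multiplicity. -/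
abbrev Sub (o : Fin t → ZMod 2) : Type := {e : Fin t → ZMod 2 // e * o = e}

/-- The element of `ℒ_o` given by `e`, namely `l = e d = ∑ k, e_k d_k`. -/
def ell {o : Fin t → ZMod 2} (e : Sub o) : D.Wt := ∑ k, (e.1 k).val • D.d k

end NenciuData

/-- The tensor product over `ℂ` of two left modules over a bialgebra `A`; `A` acts on it through
the comultiplication. -/
def HopfTensor (A V W : Type*) [Ring A] [Bialgebra ℂ A] [AddCommGroup V] [Module ℂ V]
    [AddCommGroup W] [Module ℂ W] : Type _ := V ⊗[ℂ] W

namespace HopfTensor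

variable (A V W : Type*) [Ring A] [Bialgebra ℂ A]
  [AddCommGroup V] [Module ℂ V] [Module A V] [IsScalarTower ℂ A V]
  [AddCommGroup W] [Module ℂ W] [Module A W] [IsScalarTower ℂ A W]

instance : AddCommGroup (HopfTensor A V W) := inferInstanceAs (AddCommGroup (V ⊗[ℂ] W))

/-- `h ↦ Δ h` acting on `V ⊗ W`. -/
def action : A →ₐ[ℂ] Module.End ℂ (V ⊗[ℂ] W) :=
  Module.endTensorEndAlgHom.comp
    ((Algebra.TensorProduct.map (Algebra.lsmul ℂ ℂ V) (Algebra.lsmul ℂ ℂ W)).comp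
      (Bialgebra.comulAlgHom ℂ A))

instance : Module A (HopfTensor A V W) :=
  letI : Module (Module.End ℂ (V ⊗[ℂ] W)) (HopfTensor A V W) :=
    inferInstanceAs (Module (Module.End ℂ (V ⊗[ℂ] W)) (V ⊗[ℂ] W))
  Module.compHom _ (action A V W).toRingHom

theorem smul_def (h : A) (x : V ⊗[ℂ] W) :
    (h • (show HopfTensor A V W from x)) = (action A V W h x : V ⊗[ℂ] W) := rfl

end HopfTensor

end

/-!
Call a vector `x` of an `H`-module singular of type `(r, κ)` if `K_i x = κ_i x` for all `i` and
`X_k x = 0` whenever `r_k = 1`. The generators `X ^ r ω_p` of the modules `V^r_p` are singular, and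
the whole argument compares singular vectors by dimension.

* The cyclic module of a singular vector of type `r` is spanned by the `X ^ e x` with `e` disjoint
  from `r`, because the `X_k` commute up to nonzero scalars and square to zero
  (`IsSingular.restrictScalars_span_eq`). For `V^r_p` these vectors are independent, as the explicit
  representation `monRep` on a space with basis `b_e` shows (`linearIndependent_Xmon_smul`). So
  `V^r_p` has the largest dimension possible for a module generated by such a vector
  (`finrank_V`), which gives it a universal property: it maps to every singular vector with
  the same type and eigenvalues (`IsSingular.exists_hom`).
* In `V^r_p ⊗ V^s_q`, with generators `v` and `w` of the factors, each `X ^ e v ⊗ w` is singular of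
  type `r * s`, and for `e` disjoint from `r` and `s` these vectors generate the tensor product
  (`eq_top_of_tmul_mem`). Their eigenvalues are those of the generators of the summands on the
  right-hand side, so the direct sum maps onto the tensor product.
* Both sides have the same dimension, by a count made separately at each index `k`
  (`card_Compl_mul_card_Compl`), so this surjection is an isomorphism.
-/

noncomputable section

/-! ### Ordered products -/

theorem orderedProd_succ {M : Type*} [Monoid M] {N : ℕ} (f : Fin (N + 1) → M) :
    orderedProd f = f 0 * orderedProd fun i : Fin N => f i.succ := by
  simp [orderedProd, List.ofFn_succ]

/-- A scaled commutation with every other factor lets `x` move to the empty slot `k`. -/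
theorem exists_mul_orderedProd_eq_smul_update {B : Type*} [Ring B] [Algebra ℂ B] (x : B) :
    ∀ {N : ℕ} (f : Fin N → B) (k : Fin N), f k = 1 →
      (∀ i, ∃ c : ℂ, c ≠ 0 ∧ x * f i = c • (f i * x)) →
      ∃ c : ℂ, c ≠ 0 ∧ x * orderedProd f = c • orderedProd (Function.update f k x)
  | 0, _, k, _, _ => k.elim0
  | N + 1, f, k, hk, h => by
    induction k using Fin.cases with
    | zero => exact ⟨1, one_ne_zero, by simp [orderedProd_succ, hk]⟩
    | succ k =>
      obtain ⟨c, hc, e⟩ := exists_mul_orderedProd_eq_smul_update x (fun i => f i.succ) k hk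
        fun i => h i.succ
      obtain ⟨c₀, hc₀, e₀⟩ := h 0
      have hu : (fun i : Fin N => Function.update f k.succ x i.succ)
          = Function.update (fun i : Fin N => f i.succ) k x := by
        ext i
        by_cases hi : i = k
        · subst hi; simp
        · simp [Function.update_of_ne hi, Function.update_of_ne (Fin.succ_injective _ |>.ne hi)]
      refine ⟨c₀ * c, mul_ne_zero hc₀ hc, ?_⟩
      rw [orderedProd_succ, orderedProd_succ, hu, ← mul_assoc, e₀, smul_mul_assoc, mul_assoc, e,
        mul_smul_comm, smul_smul, Function.update_of_ne (Fin.succ_ne_zero k).symm]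

theorem mul_orderedProd_eq_smul {B : Type*} [Ring B] [Algebra ℂ B] {x : B} {c : ℂ} :
    ∀ {N : ℕ} (f : Fin N → B) (i : Fin N), (∀ j, Commute x (f j)) → x * f i = c • f i →
      x * orderedProd f = c • orderedProd f
  | 0, _, i, _, _ => i.elim0
  | N + 1, f, i, h, hi => by
    rw [orderedProd_succ]
    induction i using Fin.cases with
    | zero => rw [← mul_assoc, hi, smul_mul_assoc]
    | succ i =>
      rw [← mul_assoc, (h 0).eq, mul_assoc,
        mul_orderedProd_eq_smul (fun j => f j.succ) i (fun j => h j.succ) hi, mul_smul_comm]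

theorem orderedProd_end_apply_eq_self {F : Type*} [AddCommGroup F] [Module ℂ F] {x : F} :
    ∀ {N : ℕ} (f : Fin N → Module.End ℂ F), (∀ i, f i x = x) → orderedProd f x = x
  | 0, _, _ => by simp [orderedProd]
  | N + 1, f, h => by
    rw [orderedProd_succ, Module.End.mul_apply,
      orderedProd_end_apply_eq_self (fun j => f j.succ) fun j => h j.succ, h 0]

namespace NenciuData

variable {n t : ℕ} (D : NenciuData n t)

/-! ### Commutation rules -/

/-- The character `z ↦ ξ_i ^ z` of `ℤ / m_i`. -/
def chi (i : Fin n) : AddChar (ZMod (D.m i)) ℂ :=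
  AddChar.zmodChar (D.m i) (D.prim i).pow_eq_one

theorem chi_apply (i : Fin n) (z : ZMod (D.m i)) : D.chi i z = D.ξ i ^ z.val :=
  AddChar.zmodChar_apply _ z

theorem xi_ne_zero (i : Fin n) : D.ξ i ≠ 0 := (D.prim i).ne_zero (D.m_ne i).out

theorem chi_ne_zero (i : Fin n) (z : ZMod (D.m i)) : D.chi i z ≠ 0 := by
  rw [chi_apply]; exact pow_ne_zero _ (D.xi_ne_zero i)

theorem chi_pow (i : Fin n) (z : ZMod (D.m i)) : D.chi i z ^ D.m i = 1 := by
  rw [chi_apply, ← pow_mul, mul_comm, pow_mul, (D.prim i).pow_eq_one, one_pow]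

theorem pair_ne_zero (v w : D.Wt) : D.pair v w ≠ 0 :=
  Finset.prod_ne_zero_iff.2 fun i _ => pow_ne_zero _ (D.xi_ne_zero i)

theorem exists_X_mul_X (k l : Fin t) :
    ∃ c : ℂ, c ≠ 0 ∧ D.X k * D.X l = c • (D.X l * D.X k) := by
  by_cases h : k = l
  · subst h; exact ⟨1, one_ne_zero, by simp⟩
  · exact ⟨_, D.pair_ne_zero _ _, D.X_X k l h⟩

theorem exists_X_mul_X_pow (k l : Fin t) (N : ℕ) :
    ∃ c : ℂ, c ≠ 0 ∧ D.X k * D.X l ^ N = c • (D.X l ^ N * D.X k) := by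
  obtain ⟨c, hc, h⟩ := D.exists_X_mul_X l k
  refine ⟨(c ^ N)⁻¹, inv_ne_zero (pow_ne_zero _ hc), ?_⟩
  rw [pow_smul_comm h, smul_smul, inv_mul_cancel₀ (pow_ne_zero _ hc), one_smul]

theorem exists_X_mul_Xmon (k : Fin t) (e : Fin t → ZMod 2) :
    ∃ c : ℂ, D.X k * D.Xmon e = c • (D.Xmon e * D.X k) := by
  choose c hc h using fun l => D.exists_X_mul_X l k
  have hP : (∏ l, c l ^ (e l).val) ≠ 0 :=
    Finset.prod_ne_zero_iff.2 fun l _ => pow_ne_zero _ (hc l)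
  refine ⟨(∏ l, c l ^ (e l).val)⁻¹, ?_⟩
  rw [Xmon, orderedProd_smul_comm (D.X k) _ (fun l => c l ^ (e l).val)
    fun l => pow_smul_comm (h l) _, smul_smul, inv_mul_cancel₀ hP, one_smul]

theorem exists_X_mul_Xmon_eq_smul_update {k : Fin t} {e : Fin t → ZMod 2} (he : e k = 0) :
    ∃ c : ℂ, c ≠ 0 ∧ D.X k * D.Xmon e = c • D.Xmon (Function.update e k 1) := by
  obtain ⟨c, hc, h⟩ := exists_mul_orderedProd_eq_smul_update (D.X k)
    (fun l => D.X l ^ (e l).val) k (by simp [he]) fun l => D.exists_X_mul_X_pow k l _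
  refine ⟨c, hc, h.trans ?_⟩
  congr 2
  ext l
  by_cases hl : l = k
  · subst hl; simp [ZMod.val_one]
  · simp [Function.update_of_ne hl]

theorem X_mul_Xmon_of_eq_one {k : Fin t} {e : Fin t → ZMod 2} (he : e k = 1) :
    D.X k * D.Xmon e = 0 := by
  obtain ⟨c, hc, h⟩ :=
    D.exists_X_mul_Xmon_eq_smul_update (k := k) (e := Function.update e k 0) (by simp)
  rw [Function.update_idem, ← he, Function.update_eq_self] at h
  rw [← inv_smul_smul₀ hc (D.Xmon e), ← h, mul_smul_comm, ← mul_assoc, ← pow_two, D.X_sq,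
    zero_mul, smul_zero]

@[simp] theorem Xmon_zero : D.Xmon 0 = 1 := by simp [Xmon, orderedProd]

/-- The scalar by which `K_i` commutes past `X ^ e`. -/
def commScalar (i : Fin n) (e : Fin t → ZMod 2) : ℂ := ∏ k, D.chi i (D.d k i) ^ (e k).val

theorem commScalar_ne_zero (i : Fin n) (e : Fin t → ZMod 2) : D.commScalar i e ≠ 0 :=
  Finset.prod_ne_zero_iff.2 fun _ _ => pow_ne_zero _ (D.chi_ne_zero _ _)

theorem K_mul_Xmon (i : Fin n) (e : Fin t → ZMod 2) :
    D.K i * D.Xmon e = D.commScalar i e • (D.Xmon e * D.K i) := by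
  have h : ∀ k, D.X k * D.K i = (D.chi i (D.d k i))⁻¹ • (D.K i * D.X k) := fun k => by
    rw [D.K_X, ← chi_apply, smul_smul, inv_mul_cancel₀ (D.chi_ne_zero _ _), one_smul]
  rw [Xmon, orderedProd_smul_comm (D.K i) _ (fun l => (D.chi i (D.d l i))⁻¹ ^ (e l).val)
    fun l => pow_smul_comm (h l) _, smul_smul]
  simp only [inv_pow, Finset.prod_inv_distrib]
  rw [← commScalar, mul_inv_cancel₀ (D.commScalar_ne_zero _ _), one_smul]

theorem chi_ell (i : Fin n) {o : Fin t → ZMod 2} (e : Sub o) :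
    D.chi i (D.ell e i) = D.commScalar i e.1 := by
  have h : ∀ s : Finset (Fin t), D.chi i (∑ k ∈ s, (e.1 k).val • D.d k i)
      = ∏ k ∈ s, D.chi i (D.d k i) ^ (e.1 k).val := fun s => by
    induction s using Finset.cons_induction with
    | empty => simp
    | cons k s hk ih =>
      rw [Finset.sum_cons, Finset.prod_cons, AddChar.map_add_eq_mul, AddChar.map_nsmul_eq_pow, ih]
  simp only [ell, commScalar, Finset.sum_apply, Pi.smul_apply, h]

theorem commute_K_phi (i j : Fin n) (z : ZMod (D.m j)) : Commute (D.K i) (D.phi j z) :=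
  (Commute.sum_right _ _ _ fun _ _ =>
    ((show Commute (D.K i) (D.K j) from D.K_comm i j).pow_right _).smul_right _).smul_right _

theorem K_mul_phi (i : Fin n) (z : ZMod (D.m i)) :
    D.K i * D.phi i z = (D.chi i z)⁻¹ • D.phi i z := by
  have hs : D.chi i z • (D.K i * D.phi i z) = D.phi i z := by
    rw [phi, mul_smul_comm, smul_comm, Finset.mul_sum, Finset.smul_sum]
    congr 1
    have h1 : ∀ j ∈ Finset.range (D.m i),
        D.chi i z • (D.K i * D.ξ i ^ (j * z.val) • D.K i ^ j)
          = D.ξ i ^ ((j + 1) * z.val) • D.K i ^ (j + 1) := fun j _ => by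
      rw [mul_smul_comm, ← pow_succ', smul_smul, chi_apply, ← pow_add]
      congr 2; ring
    rw [Finset.sum_congr rfl h1]
    -- Shifting the summation index changes nothing, the terms `0` and `m i` being equal.
    refine add_right_cancel ((Finset.sum_range_succ'
      (fun j => D.ξ i ^ (j * z.val) • D.K i ^ j) _).symm.trans
        ((Finset.sum_range_succ _ _).trans ?_))
    rw [D.K_pow, pow_mul, (D.prim i).pow_eq_one]
    simp
  rw [← hs, smul_smul, inv_mul_cancel₀ (D.chi_ne_zero _ _), one_smul, hs]

theorem K_mul_omega (i : Fin n) (p : D.Wt) :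
    D.K i * D.omega p = (D.chi i (p i))⁻¹ • D.omega p :=
  mul_orderedProd_eq_smul _ i (fun j => D.commute_K_phi i j (p j)) (D.K_mul_phi i (p i))

/-! ### Singular vectors -/

/-- Adding one index at a time reaches every `e : Fin t → ZMod 2` from `0`. -/
theorem update_one_induction {P : (Fin t → ZMod 2) → Prop} (h0 : P 0)
    (h1 : ∀ e k, e k = 0 → P e → P (Function.update e k 1)) (e : Fin t → ZMod 2) : P e := by
  have h : ∀ (s : Finset (Fin t)) (e : Fin t → ZMod 2), (∀ k, k ∉ s → e k = 0) → P e := by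
    intro s
    induction s using Finset.induction_on with
    | empty => intro e he; rwa [show e = 0 from funext fun k => he k (by simp)]
    | insert k s hk ih =>
      intro e he
      have hz : ∀ z : ZMod 2, z = 0 ∨ z = 1 := by decide
      rcases hz (e k) with h | h
      · refine ih e fun l hl => ?_
        by_cases hlk : l = k
        · rw [hlk, h]
        · exact he l (by simp [hlk, hl])
      · have := h1 (Function.update e k 0) k (by simp) (ih _ fun l hl => by
          by_cases hlk : l = k
          · subst hlk; simp
          · rw [Function.update_of_ne hlk]; exact he l (by simp [hlk, hl]))
        rwa [Function.update_idem, ← h, Function.update_eq_self] at this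
  exact h Finset.univ e (by simp)

section Singular

variable {W : Type*} [AddCommGroup W] [Module ℂ W] [Module D.Alg W] [IsScalarTower ℂ D.Alg W]

/-- `x` is a simultaneous eigenvector of the `K_i`, with eigenvalues `κ i`, and is killed by
every `X_k` with `r k = 1`. -/
structure IsSingular (r : Fin t → ZMod 2) (κ : Fin n → ℂ) (x : W) : Prop where
  K_smul : ∀ i, D.K i • x = κ i • x
  X_smul : ∀ k, r k = 1 → D.X k • x = 0

/-- The exponents of the monomials that need not kill a singular vector of type `r`. -/
abbrev Compl (r : Fin t → ZMod 2) : Type := {e : Fin t → ZMod 2 // e * r = 0}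

variable {D}

/-- Stability under the generators suffices, since `H` is a quotient of the free algebra. -/
theorem smul_mem_of_generators {S : Submodule ℂ W} (hK : ∀ i, ∀ x ∈ S, D.K i • x ∈ S)
    (hX : ∀ k, ∀ x ∈ S, D.X k • x ∈ S) (h : D.Alg) : ∀ x ∈ S, h • x ∈ S := by
  obtain ⟨h, rfl⟩ := RingQuot.mkAlgHom_surjective ℂ D.Rel h
  change ∀ x ∈ S, D.quot h • x ∈ S
  induction h using FreeAlgebra.induction with
  | grade0 c =>
    intro x hx
    rw [AlgHom.commutes, algebraMap_smul]
    exact S.smul_mem c hx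
  | grade1 g =>
    cases g with
    | inl i => exact hK i
    | inr k => exact hX k
  | mul a b ha hb =>
    intro x hx
    rw [map_mul, mul_smul]
    exact ha _ (hb _ hx)
  | add a b ha hb =>
    intro x hx
    rw [map_add, add_smul]
    exact S.add_mem (ha _ hx) (hb _ hx)

theorem smul_comm_complex (c : ℂ) (h : D.Alg) (x : W) : h • c • x = c • h • x := by
  rw [← algebraMap_smul D.Alg c x, ← algebraMap_smul D.Alg c (h • x), smul_smul, smul_smul,
    Algebra.commutes]

theorem smul_mem_span {ι : Type*} {v : ι → W} {h : D.Alg}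
    (hv : ∀ i, h • v i ∈ Submodule.span ℂ (Set.range v)) :
    ∀ x ∈ Submodule.span ℂ (Set.range v), h • x ∈ Submodule.span ℂ (Set.range v) := by
  intro x hx
  induction hx using Submodule.span_induction with
  | mem x hx => obtain ⟨i, rfl⟩ := hx; exact hv i
  | zero => rw [smul_zero]; exact Submodule.zero_mem _
  | add x y _ _ hx hy => rw [smul_add]; exact Submodule.add_mem _ hx hy
  | smul c x _ hx => rw [smul_comm_complex]; exact Submodule.smul_mem _ c hx

theorem IsSingular.K_smul_Xmon {r : Fin t → ZMod 2} {κ : Fin n → ℂ} {x : W}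
    (hx : D.IsSingular r κ x) (i : Fin n) (e : Fin t → ZMod 2) :
    D.K i • D.Xmon e • x = (D.commScalar i e * κ i) • D.Xmon e • x := by
  rw [smul_smul, D.K_mul_Xmon, smul_assoc, mul_smul, hx.K_smul, smul_comm_complex, smul_smul]

theorem IsSingular.X_smul_Xmon {r : Fin t → ZMod 2} {κ : Fin n → ℂ} {x : W}
    (hx : D.IsSingular r κ x) {k : Fin t} (hk : r k = 1) (e : Fin t → ZMod 2) :
    D.X k • D.Xmon e • x = 0 := by
  obtain ⟨c, h⟩ := D.exists_X_mul_Xmon k e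
  rw [smul_smul, h, smul_assoc, mul_smul, hx.X_smul k hk, smul_zero, smul_zero]

/-- The monomials avoiding `r` span the cyclic submodule of a singular vector. -/
theorem IsSingular.smul_mem_span_Xmon {r : Fin t → ZMod 2} {κ : Fin n → ℂ} {x : W}
    (hx : D.IsSingular r κ x) (h : D.Alg) :
    h • x ∈ Submodule.span ℂ (Set.range fun e : Compl r => D.Xmon e.1 • x) := by
  have hz : ∀ z : ZMod 2, z = 0 ∨ z = 1 := by decide
  refine smul_mem_of_generators (fun i => smul_mem_span fun e => ?_)
    (fun k => smul_mem_span fun e => ?_) h x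
    (Submodule.subset_span ⟨⟨0, by simp⟩, by simp⟩)
  · rw [hx.K_smul_Xmon]
    exact Submodule.smul_mem _ _ (Submodule.subset_span ⟨e, rfl⟩)
  · rcases hz (r k) with hr | hr
    · rcases hz (e.1 k) with he | he
      · obtain ⟨c, -, h⟩ := D.exists_X_mul_Xmon_eq_smul_update he
        rw [smul_smul, h, smul_assoc]
        refine Submodule.smul_mem _ _ (Submodule.subset_span ⟨⟨Function.update e.1 k 1, ?_⟩, rfl⟩)
        ext l
        by_cases hl : l = k
        · subst hl; simp [hr]
        · simpa [Function.update_of_ne hl] using congrFun e.2 l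
      · rw [smul_smul, D.X_mul_Xmon_of_eq_one he, zero_smul]
        exact Submodule.zero_mem _
    · rw [hx.X_smul_Xmon hr]
      exact Submodule.zero_mem _

theorem IsSingular.restrictScalars_span_eq {r : Fin t → ZMod 2} {κ : Fin n → ℂ} {x : W}
    (hx : D.IsSingular r κ x) :
    (Submodule.span D.Alg {x}).restrictScalars ℂ =
      Submodule.span ℂ (Set.range fun e : Compl r => D.Xmon e.1 • x) := by
  refine le_antisymm (fun y hy => ?_) (Submodule.span_le.2 ?_)
  · obtain ⟨h, rfl⟩ := Submodule.mem_span_singleton.1 hy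
    exact hx.smul_mem_span_Xmon h
  · rintro _ ⟨e, rfl⟩
    exact Submodule.smul_mem _ _ (Submodule.mem_span_singleton_self x)

theorem IsSingular.finite_span {r : Fin t → ZMod 2} {κ : Fin n → ℂ} {x : W}
    (hx : D.IsSingular r κ x) : Module.Finite ℂ (Submodule.span D.Alg {x}) := by
  have : Module.Finite ℂ ((Submodule.span D.Alg {x}).restrictScalars ℂ) := by
    rw [hx.restrictScalars_span_eq]
    exact Module.Finite.span_of_finite ℂ (Set.finite_range _)
  exact this

theorem IsSingular.finrank_span_le {r : Fin t → ZMod 2} {κ : Fin n → ℂ} {x : W}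
    (hx : D.IsSingular r κ x) :
    Module.finrank ℂ (Submodule.span D.Alg {x}) ≤ Fintype.card (Compl r) := by
  change Module.finrank ℂ ((Submodule.span D.Alg {x}).restrictScalars ℂ) ≤ _
  rw [hx.restrictScalars_span_eq]
  exact finrank_range_le_card _

end Singular

/-! ### The monomial representation -/

/-- The vector space with basis `b_e`, for `e : Fin t → ZMod 2`. -/
abbrev MonSpace (t : ℕ) : Type := (Fin t → ZMod 2) →₀ ℂ

/-- The basis vector `b_e`. -/
abbrev monBasis (e : Fin t → ZMod 2) : MonSpace t := Finsupp.single e 1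

/-- The scalar picked up when `X_k` is moved into its place in `X ^ e`. -/
def moveScalar (k : Fin t) (e : Fin t → ZMod 2) : ℂ :=
  ∏ l ∈ Finset.univ.filter fun l => l < k ∧ e l = 1, D.pair (D.u k) (D.d l)

theorem moveScalar_ne_zero (k : Fin t) (e : Fin t → ZMod 2) : D.moveScalar k e ≠ 0 :=
  Finset.prod_ne_zero_iff.2 fun _ _ => D.pair_ne_zero _ _

theorem moveScalar_update {k l : Fin t} {e : Fin t → ZMod 2} (he : e l = 0) :
    D.moveScalar k (Function.update e l 1) =
      (if l < k then D.pair (D.u k) (D.d l) else 1) * D.moveScalar k e := by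
  have hu : ∀ j, Function.update e l 1 j = 1 ↔ j = l ∨ e j = 1 := fun j => by
    by_cases hj : j = l
    · subst hj; simp
    · simp [hj]
  split_ifs with h
  · refine (Finset.prod_congr (Finset.ext fun j => ?_) fun _ _ => rfl).trans
      (Finset.prod_insert (by simp [he]))
    simp only [Finset.mem_filter, Finset.mem_univ, true_and, Finset.mem_insert, hu]
    constructor
    · rintro ⟨h1, h2 | h2⟩
      · exact Or.inl h2
      · exact Or.inr ⟨h1, h2⟩
    · rintro (rfl | ⟨h1, h2⟩)
      · exact ⟨h, Or.inl rfl⟩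
      · exact ⟨h1, Or.inr h2⟩
  · rw [moveScalar, moveScalar, one_mul]
    refine Finset.prod_congr (Finset.ext fun j => ?_) fun _ _ => rfl
    simp only [Finset.mem_filter, Finset.mem_univ, true_and, hu]
    refine and_congr_right fun hj => or_iff_right ?_
    rintro rfl
    exact h hj

/-- The action of `X_k`, with `b_e` playing the role of `X ^ e ω_p`: `b_e` goes to a multiple of
`b_{e + k}`, or to zero if `e k = 1`. -/
def monX (k : Fin t) : Module.End ℂ (MonSpace t) :=
  Finsupp.linearCombination ℂ fun e =>
    if e k = 0 then D.moveScalar k e • monBasis (Function.update e k 1) else 0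

theorem monX_of_eq_zero {k : Fin t} {e : Fin t → ZMod 2} (he : e k = 0) :
    D.monX k (monBasis e) = D.moveScalar k e • monBasis (Function.update e k 1) := by
  rw [monX, monBasis, Finsupp.linearCombination_single, one_smul, if_pos he]

theorem monX_of_ne_zero {k : Fin t} {e : Fin t → ZMod 2} (he : e k ≠ 0) :
    D.monX k (monBasis e) = 0 := by
  rw [monX, monBasis, Finsupp.linearCombination_single, one_smul, if_neg he]

/-- The action of `K_i`: `b_0` has eigenvalue `κ`, and `X_k` multiplies it by `ξ_i ^ (d_k)_i`. -/
def monK (i : Fin n) (κ : ℂ) : Module.End ℂ (MonSpace t) :=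
  Finsupp.linearCombination ℂ fun e => (D.commScalar i e * κ) • monBasis e

theorem monK_apply (i : Fin n) (κ : ℂ) (e : Fin t → ZMod 2) :
    D.monK i κ (monBasis e) = (D.commScalar i e * κ) • monBasis e := by
  rw [monK, monBasis, Finsupp.linearCombination_single, one_smul]

theorem monSpace_end_ext {f g : Module.End ℂ (MonSpace t)}
    (h : ∀ e, f (monBasis e) = g (monBasis e)) : f = g :=
  Finsupp.lhom_ext' fun e => LinearMap.ext_ring (h e)

theorem commScalar_update (i : Fin n) {k : Fin t} {e : Fin t → ZMod 2} (he : e k = 0) :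
    D.commScalar i (Function.update e k 1) = D.chi i (D.d k i) * D.commScalar i e := by
  have h : ∀ e' : Fin t → ZMod 2, D.commScalar i e' = D.chi i (D.d k i) ^ (e' k).val *
      ∏ l ∈ Finset.univ.erase k, D.chi i (D.d l i) ^ (e' l).val := fun e' =>
    (Finset.mul_prod_erase _ _ (Finset.mem_univ k)).symm
  rw [h, h e, he, Function.update_self, ZMod.val_one, ZMod.val_zero, pow_one, pow_zero, one_mul]
  congr 1
  refine Finset.prod_congr rfl fun l hl => ?_
  rw [Function.update_of_ne (Finset.ne_of_mem_erase hl)]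

theorem commScalar_pow (i : Fin n) (e : Fin t → ZMod 2) : D.commScalar i e ^ D.m i = 1 := by
  rw [commScalar, ← Finset.prod_pow]
  refine Finset.prod_eq_one fun k _ => ?_
  rw [← pow_mul, mul_comm, pow_mul, D.chi_pow, one_pow]

theorem monX_monX {k l : Fin t} (hkl : k ≠ l) :
    D.monX k * D.monX l = D.pair (D.u k) (D.d l) • (D.monX l * D.monX k) := by
  refine monSpace_end_ext fun e => ?_
  simp only [Module.End.mul_apply, LinearMap.smul_apply]
  by_cases hk : e k = 0 <;> by_cases hl : e l = 0
  · have hk' : Function.update e l 1 k = 0 := by rwa [Function.update_of_ne hkl]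
    have hl' : Function.update e k 1 l = 0 := by rwa [Function.update_of_ne hkl.symm]
    have h1 : D.pair (D.u k) (D.d l) * D.pair (D.u l) (D.d k) = 1 := D.offdiag k l hkl
    rw [D.monX_of_eq_zero hl, D.monX_of_eq_zero hk, map_smul, map_smul, D.monX_of_eq_zero hk',
      D.monX_of_eq_zero hl', Function.update_comm hkl.symm, D.moveScalar_update hl,
      D.moveScalar_update hk, smul_smul, smul_smul, smul_smul]
    congr 1
    rcases lt_or_gt_of_ne hkl with h | h
    · rw [if_neg h.not_gt, if_pos h]
      linear_combination (-D.moveScalar k e * D.moveScalar l e) * h1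
    · rw [if_pos h, if_neg h.not_gt]
      ring
  · have hl' : Function.update e k 1 l ≠ 0 := by rwa [Function.update_of_ne hkl.symm]
    rw [D.monX_of_ne_zero hl, D.monX_of_eq_zero hk, map_smul, D.monX_of_ne_zero hl']
    simp
  · have hk' : Function.update e l 1 k ≠ 0 := by rwa [Function.update_of_ne hkl]
    rw [D.monX_of_eq_zero hl, D.monX_of_ne_zero hk, map_smul, D.monX_of_ne_zero hk']
    simp
  · rw [D.monX_of_ne_zero hl, D.monX_of_ne_zero hk]
    simp

theorem monX_sq (k : Fin t) : D.monX k ^ 2 = 0 := by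
  refine monSpace_end_ext fun e => ?_
  rw [pow_two, Module.End.mul_apply]
  by_cases hk : e k = 0
  · rw [D.monX_of_eq_zero hk, map_smul, D.monX_of_ne_zero (by simp), smul_zero,
      LinearMap.zero_apply]
  · rw [D.monX_of_ne_zero hk, map_zero, LinearMap.zero_apply]

theorem monK_monX (i : Fin n) (κ : ℂ) (k : Fin t) :
    D.monK i κ * D.monX k = D.ξ i ^ (D.d k i).val • (D.monX k * D.monK i κ) := by
  refine monSpace_end_ext fun e => ?_
  rw [LinearMap.smul_apply, Module.End.mul_apply, Module.End.mul_apply, monK_apply, map_smul]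
  by_cases hk : e k = 0
  · rw [D.monX_of_eq_zero hk, map_smul, monK_apply, D.commScalar_update i hk, smul_smul, smul_smul,
      smul_smul, chi_apply]
    congr 1
    ring
  · rw [D.monX_of_ne_zero hk, map_zero, smul_zero, smul_zero]

theorem monK_pow_apply (i : Fin n) (κ : ℂ) (N : ℕ) (e : Fin t → ZMod 2) :
    (D.monK i κ ^ N) (monBasis e) = (D.commScalar i e * κ) ^ N • monBasis e := by
  induction N with
  | zero => simp
  | succ N ih =>
    rw [pow_succ, Module.End.mul_apply, monK_apply, map_smul, ih, smul_smul, pow_succ, mul_comm]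

/-- The representation of `H` on `MonSpace t` in which `K_i` has eigenvalue `ξ_i ^ (-p_i)` on
`b_0`. It is the projective module `H ω_p` in its monomial basis. -/
def monRep (p : D.Wt) : D.Alg →ₐ[ℂ] Module.End ℂ (MonSpace t) :=
  D.lift (fun i => D.monK i (D.chi i (p i))⁻¹) D.monX
    (fun i j => monSpace_end_ext fun e => by
      simp only [Module.End.mul_apply, monK_apply, map_smul, smul_smul]
      rw [mul_comm])
    (fun i => monSpace_end_ext fun e => by
      rw [monK_pow_apply, mul_pow, commScalar_pow, inv_pow, chi_pow, inv_one, one_mul, one_smul,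
        Module.End.one_apply])
    (fun i k => D.monK_monX i _ k) (fun _ _ h => D.monX_monX h) D.monX_sq

theorem monRep_X (p : D.Wt) (k : Fin t) : D.monRep p (D.X k) = D.monX k := by
  rw [monRep, lift_X]

theorem monRep_K (p : D.Wt) (i : Fin n) :
    D.monRep p (D.K i) = D.monK i (D.chi i (p i))⁻¹ := by
  rw [monRep, lift_K]

theorem monRep_omega (p : D.Wt) : D.monRep p (D.omega p) (monBasis 0) = monBasis 0 := by
  rw [omega, map_orderedProd]
  refine orderedProd_end_apply_eq_self _ fun i => ?_
  have hm : (D.m i : ℂ) ≠ 0 := Nat.cast_ne_zero.2 (D.m_ne i).out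
  have h0 : D.commScalar i 0 = 1 := by simp [commScalar]
  have hj : ∀ j : ℕ, D.ξ i ^ (j * (p i).val) * ((D.chi i (p i))⁻¹) ^ j = 1 := fun j => by
    rw [chi_apply, inv_pow, ← pow_mul, mul_comm j]
    exact mul_inv_cancel₀ (pow_ne_zero _ (D.xi_ne_zero i))
  simp only [phi, map_smul, map_sum, map_pow, monRep_K, LinearMap.smul_apply,
    LinearMap.sum_apply, monK_pow_apply, h0, one_mul, smul_smul, hj, one_smul, Finset.sum_const,
    Finset.card_range]
  rw [← Nat.cast_smul_eq_nsmul ℂ, smul_smul, one_div, inv_mul_cancel₀ hm, one_smul]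

/-- As `X_k X ^ e` is a nonzero multiple of `X ^ (e + k)`, the scalars of the `X_k` never vanish
along the way from `b_f` to `b_{e + f}`. -/
theorem exists_monRep_Xmon (p : D.Wt) (f e : Fin t → ZMod 2) : e * f = 0 →
    ∃ c : ℂ, c ≠ 0 ∧ D.monRep p (D.Xmon e) (monBasis f) = c • monBasis (e + f) := by
  induction e using update_one_induction with
  | h0 => exact fun _ => ⟨1, one_ne_zero, by simp⟩
  | h1 e k he ih =>
    intro h
    have hf : f k = 0 := by simpa using congrFun h k
    have hef : e * f = 0 := by
      ext l
      by_cases hl : l = k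
      · subst hl; simp [he]
      · simpa [Function.update_of_ne hl] using congrFun h l
    obtain ⟨c, hc, h1⟩ := ih hef
    obtain ⟨c', hc', h2⟩ := D.exists_X_mul_Xmon_eq_smul_update he
    have h3 : Function.update (e + f) k 1 = Function.update e k 1 + f := by
      ext l
      by_cases hl : l = k
      · subst hl; simp [hf]
      · simp [Function.update_of_ne hl]
    have h4 : c' • D.monRep p (D.Xmon (Function.update e k 1)) (monBasis f)
        = (c * D.moveScalar k (e + f)) • monBasis (Function.update e k 1 + f) := by
      rw [← LinearMap.smul_apply, ← map_smul, ← h2, map_mul, Module.End.mul_apply, h1, map_smul,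
        monRep_X, D.monX_of_eq_zero (by simp [he, hf]), smul_smul, h3]
    refine ⟨c'⁻¹ * (c * D.moveScalar k (e + f)),
      mul_ne_zero (inv_ne_zero hc') (mul_ne_zero hc (D.moveScalar_ne_zero _ _)), ?_⟩
    rw [mul_smul, ← h4, inv_smul_smul₀ hc']

/-- In the monomial representation, `X ^ e X ^ r ω_p` sends `b_0` to a nonzero multiple of
`b_{e + r}`, and these basis vectors are distinct. -/
theorem linearIndependent_Xmon_smul (r : Fin t → ZMod 2) (p : D.Wt) :
    LinearIndependent ℂ fun e : Compl r => D.Xmon e.1 * (D.Xmon r * D.omega p) := by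
  obtain ⟨c, hc, h⟩ := D.exists_monRep_Xmon p 0 r (by simp)
  choose c' hc' h' using fun e : Compl r => D.exists_monRep_Xmon p r e.1 e.2
  let ev : D.Alg →ₗ[ℂ] MonSpace t :=
    (LinearMap.applyₗ (monBasis 0)).comp (D.monRep p).toLinearMap
  have hev : (ev ∘ fun e : Compl r => D.Xmon e.1 * (D.Xmon r * D.omega p))
      = fun e : Compl r => (c * c' e) • monBasis (e.1 + r) := by
    funext e
    change D.monRep p (D.Xmon e.1 * (D.Xmon r * D.omega p)) (monBasis 0) = _
    rw [map_mul, map_mul, Module.End.mul_apply, Module.End.mul_apply, monRep_omega, h, map_smul,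
      add_zero, h', smul_smul]
  refine LinearIndependent.of_comp ev ?_
  rw [hev]
  have hb : LinearIndependent ℂ fun e : Compl r => monBasis (e.1 + r) :=
    (Finsupp.linearIndependent_single_one ℂ (Fin t → ZMod 2)).comp _
      fun e e' hee => Subtype.ext (add_right_cancel hee)
  exact hb.units_smul fun e => Units.mk0 _ (mul_ne_zero hc (hc' e))

/-! ### The modules `V^r_p` -/

/-- The generator `X ^ r ω_p` of `V^r_p`. -/
def gen (r : Fin t → ZMod 2) (p : D.Wt) : D.V r p :=
  ⟨D.Xmon r * D.omega p, Submodule.mem_span_singleton_self _⟩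

theorem exists_smul_gen {r : Fin t → ZMod 2} {p : D.Wt} (y : D.V r p) :
    ∃ h : D.Alg, h • D.gen r p = y := by
  obtain ⟨h, hh⟩ := Submodule.mem_span_singleton.1 y.2
  exact ⟨h, Subtype.ext hh⟩

theorem isSingular_Xmon_mul_omega {r : Fin t → ZMod 2} {a : D.Wt} (ha : D.IsCommExp r a)
    (p : D.Wt) : D.IsSingular r (fun i => D.chi i (a i - p i)) (D.Xmon r * D.omega p) where
  K_smul i := by
    rw [smul_eq_mul, ← mul_assoc, ha i, smul_mul_assoc, mul_assoc, D.K_mul_omega, mul_smul_comm,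
      smul_smul, ← chi_apply, sub_eq_add_neg, AddChar.map_add_eq_mul, AddChar.map_neg_eq_inv]
  X_smul k hk := by
    rw [smul_eq_mul, ← mul_assoc, D.X_mul_Xmon_of_eq_one hk, zero_mul]

theorem isSingular_gen {r : Fin t → ZMod 2} {a : D.Wt} (ha : D.IsCommExp r a) (p : D.Wt) :
    D.IsSingular r (fun i => D.chi i (a i - p i)) (D.gen r p) where
  K_smul i := Subtype.ext ((D.isSingular_Xmon_mul_omega ha p).K_smul i)
  X_smul k hk := Subtype.ext ((D.isSingular_Xmon_mul_omega ha p).X_smul k hk)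

theorem finite_V {r : Fin t → ZMod 2} {a : D.Wt} (ha : D.IsCommExp r a) (p : D.Wt) :
    Module.Finite ℂ (D.V r p) := (D.isSingular_Xmon_mul_omega ha p).finite_span

theorem finrank_V {r : Fin t → ZMod 2} {a : D.Wt} (ha : D.IsCommExp r a) (p : D.Wt) :
    Module.finrank ℂ (D.V r p) = Fintype.card (Compl r) := by
  have := D.finite_V ha p
  refine le_antisymm (D.isSingular_Xmon_mul_omega ha p).finrank_span_le ?_
  have hli : LinearIndependent ℂ fun e : Compl r => D.Xmon e.1 • D.gen r p :=
    LinearIndependent.of_comp ((D.V r p).subtype.restrictScalars ℂ)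
      (D.linearIndependent_Xmon_smul r p)
  exact hli.fintype_card_le_finrank

section Hom

variable {W : Type*} [AddCommGroup W] [Module ℂ W] [Module D.Alg W] [IsScalarTower ℂ D.Alg W]

variable {D}

/-- Universal property of `V^r_p`: a singular vector with the type and the eigenvalues of
`X ^ r ω_p` is the image of `X ^ r ω_p`. The map is read off from its graph, the submodule `C` of
`H × W` generated by `(X ^ r ω_p, w)`: it projects onto `V^r_p`, and its dimension is at most
that of `V^r_p`. -/
theorem IsSingular.exists_hom {r : Fin t → ZMod 2} {a : D.Wt} (ha : D.IsCommExp r a) (p : D.Wt)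
    {w : W} (hw : D.IsSingular r (fun i => D.chi i (a i - p i)) w) :
    ∃ f : D.V r p →ₗ[D.Alg] W, f (D.gen r p) = w := by
  have hg := D.isSingular_gen ha p
  have hx : D.IsSingular r (fun i => D.chi i (a i - p i)) ((D.gen r p, w) : D.V r p × W) :=
    ⟨fun i => Prod.ext (hg.K_smul i) (hw.K_smul i),
      fun k hk => Prod.ext (hg.X_smul k hk) (hw.X_smul k hk)⟩
  set C := Submodule.span D.Alg {((D.gen r p, w) : D.V r p × W)} with hC
  have : Module.Finite ℂ C := hx.finite_span
  have := D.finite_V ha p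
  let x : C := ⟨_, Submodule.mem_span_singleton_self _⟩
  let π : C →ₗ[D.Alg] D.V r p := (LinearMap.fst D.Alg _ _).comp C.subtype
  have hπx : π x = D.gen r p := rfl
  have hsurj : Function.Surjective π := fun y => by
    obtain ⟨h, rfl⟩ := D.exists_smul_gen y
    exact ⟨h • x, by rw [map_smul, hπx]⟩
  have hinj : Function.Injective π := by
    have hle : Module.finrank ℂ C ≤ Module.finrank ℂ (D.V r p) :=
      hx.finrank_span_le.trans (D.finrank_V ha p).ge
    have hge : Module.finrank ℂ (D.V r p) ≤ Module.finrank ℂ C :=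
      LinearMap.finrank_le_finrank_of_surjective (f := π.restrictScalars ℂ) hsurj
    exact (LinearMap.injective_iff_surjective_of_finrank_eq_finrank (f := π.restrictScalars ℂ)
      (le_antisymm hle hge)).2 hsurj
  let E := LinearEquiv.ofBijective π ⟨hinj, hsurj⟩
  refine ⟨((LinearMap.snd D.Alg _ _).comp C.subtype).comp E.symm.toLinearMap, ?_⟩
  have : E.symm (D.gen r p) = x := by rw [LinearEquiv.symm_apply_eq]; rfl
  simp only [LinearMap.comp_apply, LinearEquiv.coe_coe, this]
  rfl

end Hom

end NenciuData

/-! ### Jointly surjective maps -/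

/-- A family of maps that jointly generate `T` identifies `T` with the direct sum of the sources
as soon as the dimensions over `ℂ` agree. -/
theorem nonempty_linearEquiv_directSum {A ι T : Type*} [Ring A] [Algebra ℂ A] [Fintype ι]
    {M : ι → Type*} [∀ i, AddCommGroup (M i)] [∀ i, Module ℂ (M i)] [∀ i, Module A (M i)]
    [∀ i, IsScalarTower ℂ A (M i)] [∀ i, Module.Finite ℂ (M i)]
    [AddCommGroup T] [Module ℂ T] [Module A T] [IsScalarTower ℂ A T] [Module.Finite ℂ T]
    (f : ∀ i, M i →ₗ[A] T) (hf : ⨆ i, LinearMap.range (f i) = ⊤)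
    (hdim : Module.finrank ℂ (⨁ i, M i) = Module.finrank ℂ T) :
    Nonempty (T ≃ₗ[A] ⨁ i, M i) := by
  classical
  let F : (⨁ i, M i) →ₗ[A] T := DirectSum.toModule A ι T f
  have hsurj : Function.Surjective F := by
    rw [← LinearMap.range_eq_top, eq_top_iff, ← hf]
    refine iSup_le fun i => ?_
    rintro _ ⟨x, rfl⟩
    exact ⟨DirectSum.lof A ι M i x, DirectSum.toModule_lof A i x⟩
  have hinj : Function.Injective F :=
    (LinearMap.injective_iff_surjective_of_finrank_eq_finrank (f := F.restrictScalars ℂ) hdim).2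
      hsurj
  exact ⟨(LinearEquiv.ofBijective F ⟨hinj, hsurj⟩).symm⟩

/-! ### Tensor products -/

namespace HopfTensor

section Complex

variable (A : Type*) {V W : Type*} [Ring A] [Bialgebra ℂ A]
  [AddCommGroup V] [Module ℂ V] [AddCommGroup W] [Module ℂ W]

instance : Module ℂ (HopfTensor A V W) := inferInstanceAs (Module ℂ (V ⊗[ℂ] W))

/-- The pure tensor `x ⊗ y`, as an element of the `A`-module `V ⊗ W`. -/
def tmul (x : V) (y : W) : HopfTensor A V W := x ⊗ₜ[ℂ] y

theorem add_tmul (x x' : V) (y : W) : tmul A (x + x') y = tmul A x y + tmul A x' y :=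
  TensorProduct.add_tmul x x' y

theorem tmul_add (x : V) (y y' : W) : tmul A x (y + y') = tmul A x y + tmul A x y' :=
  TensorProduct.tmul_add x y y'

theorem smul_tmul' (c : ℂ) (x : V) (y : W) : tmul A (c • x) y = c • tmul A x y :=
  (TensorProduct.smul_tmul' c x y).symm

theorem tmul_smul (c : ℂ) (x : V) (y : W) : tmul A x (c • y) = c • tmul A x y :=
  TensorProduct.tmul_smul c x y

theorem zero_tmul (y : W) : tmul A (0 : V) y = 0 := TensorProduct.zero_tmul V y

theorem tmul_zero (x : V) : tmul A x (0 : W) = 0 := TensorProduct.tmul_zero W x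

end Complex

variable {A V W : Type*} [Ring A] [Bialgebra ℂ A]
  [AddCommGroup V] [Module ℂ V] [Module A V] [IsScalarTower ℂ A V]
  [AddCommGroup W] [Module ℂ W] [Module A W] [IsScalarTower ℂ A W]

instance : IsScalarTower ℂ A (HopfTensor A V W) where
  smul_assoc c h x := by
    exact LinearMap.congr_fun (map_smul (action A V W) c h) (show V ⊗[ℂ] W from x)

theorem submodule_eq_top {N : Submodule A (HopfTensor A V W)}
    (h : ∀ (x : V) (y : W), tmul A x y ∈ N) : N = ⊤ := by
  refine Submodule.eq_top_iff'.2 fun z => ?_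
  change V ⊗[ℂ] W at z
  induction z using TensorProduct.induction_on with
  | zero => exact N.zero_mem
  | tmul x y => exact h x y
  | add z z' hz hz' => exact N.add_mem hz hz'

end HopfTensor

namespace NenciuData

variable {n t : ℕ} {D : NenciuData n t}

open HopfTensor

section Tensor

variable {V W : Type*}
  [AddCommGroup V] [Module ℂ V] [Module D.Alg V] [IsScalarTower ℂ D.Alg V]
  [AddCommGroup W] [Module ℂ W] [Module D.Alg W] [IsScalarTower ℂ D.Alg W]

theorem K_smul_tmul (i : Fin n) (x : V) (y : W) :
    D.K i • tmul D.Alg x y = tmul D.Alg (D.K i • x) (D.K i • y) := by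
  have h : Bialgebra.comulAlgHom ℂ D.Alg (D.K i) = D.K i ⊗ₜ[ℂ] D.K i := D.comulHom_K i
  change action D.Alg V W (D.K i) (x ⊗ₜ[ℂ] y) = (D.K i • x) ⊗ₜ[ℂ] (D.K i • y)
  simp [action, h, Module.endTensorEndAlgHom_apply]

theorem X_smul_tmul (k : Fin t) (x : V) (y : W) :
    D.X k • tmul D.Alg x y = tmul D.Alg x (D.X k • y) + tmul D.Alg (D.X k • x) (D.L k • y) := by
  have h : Bialgebra.comulAlgHom ℂ D.Alg (D.X k) = 1 ⊗ₜ[ℂ] D.X k + D.X k ⊗ₜ[ℂ] D.L k :=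
    D.comulHom_X k
  change action D.Alg V W (D.X k) (x ⊗ₜ[ℂ] y)
    = x ⊗ₜ[ℂ] (D.X k • y) + (D.X k • x) ⊗ₜ[ℂ] (D.L k • y)
  simp [action, h, Module.endTensorEndAlgHom_apply]

theorem K_smul_pow_pred_smul {V : Type*} [AddCommGroup V] [Module D.Alg V] (i : Fin n)
    (x : V) : D.K i • D.K i ^ (D.m i - 1) • x = x := by
  rw [smul_smul, ← pow_succ', Nat.sub_add_cancel (Nat.pos_of_ne_zero (D.m_ne i).out), D.K_pow,
    one_smul]

/-- Every grouplike monomial acts on a simultaneous eigenvector of the `K_i` by a nonzero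
scalar. -/
theorem exists_Kmon_smul {κ : Fin n → ℂ} (hκ : ∀ i, κ i ≠ 0) {y : W}
    (hy : ∀ i, D.K i • y = κ i • y) (v : D.Wt) :
    ∃ c : ℂ, c ≠ 0 ∧ D.Kmon v • y = c • y := by
  have hpow : ∀ (i : Fin n) (N : ℕ), D.K i ^ N • y = κ i ^ N • y := fun i N => by
    induction N with
    | zero => simp
    | succ N ih => rw [pow_succ, mul_smul, hy, smul_comm_complex, ih, smul_smul, pow_succ']
  have key : ∀ {N : ℕ} (f : Fin N → D.Alg), (∀ i, ∃ c : ℂ, c ≠ 0 ∧ f i • y = c • y) →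
      ∃ c : ℂ, c ≠ 0 ∧ orderedProd f • y = c • y := by
    intro N
    induction N with
    | zero => exact fun f _ => ⟨1, one_ne_zero, by simp [orderedProd]⟩
    | succ N ih =>
      intro f h
      obtain ⟨c, hc, e⟩ := ih (fun i => f i.succ) fun i => h i.succ
      obtain ⟨c₀, hc₀, e₀⟩ := h 0
      exact ⟨c * c₀, mul_ne_zero hc hc₀, by
        rw [orderedProd_succ, mul_smul, e, smul_comm_complex, e₀, smul_smul]⟩
  exact key _ fun i => ⟨_, pow_ne_zero _ (hκ i), hpow i _⟩

/-- If `v` and `w` generate `V` and `W`, a submodule of `V ⊗ W` containing all `X ^ e v ⊗ w`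
with `e` avoiding `r` and `s` is everything. The relation `X_k (x ⊗ w) = X_k x ⊗ L_k w` for
`s k = 1` first gives `V ⊗ w`, and `X_k (x ⊗ y) = x ⊗ X_k y + X_k x ⊗ L_k y` then lets `y` run
through `W`. -/
theorem eq_top_of_tmul_mem {r s : Fin t → ZMod 2} {κ μ : Fin n → ℂ} (hμ : ∀ i, μ i ≠ 0)
    {v : V} {w : W} (hv : D.IsSingular r κ v) (hw : D.IsSingular s μ w)
    (hv' : ∀ x : V, ∃ h : D.Alg, h • v = x) (hw' : ∀ y : W, ∃ h : D.Alg, h • w = y)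
    {N : Submodule D.Alg (HopfTensor D.Alg V W)}
    (hN : ∀ e : Fin t → ZMod 2, e * r = 0 → e * s = 0 → tmul D.Alg (D.Xmon e • v) w ∈ N) :
    N = ⊤ := by
  have hc : ∀ (c : ℂ) {z}, z ∈ N → c • z ∈ N := fun c z hz => N.smul_of_tower_mem c hz
  have hz : ∀ z : ZMod 2, z = 0 ∨ z = 1 := by decide
  -- The monomials avoiding `r`, by induction on the number of their indices in `s`.
  have h1 : ∀ (A : Finset (Fin t)) (e : Fin t → ZMod 2), e * r = 0 →
      (∀ k, k ∉ A → e k * s k = 0) → tmul D.Alg (D.Xmon e • v) w ∈ N := by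
    intro A
    induction A using Finset.induction_on with
    | empty => exact fun e her hes => hN e her (funext fun k => hes k (by simp))
    | insert k A hk ih =>
      intro e her hes
      by_cases hek : e k * s k = 0
      · refine ih e her fun l hl => ?_
        by_cases hlk : l = k
        · rw [hlk, hek]
        · exact hes l (by simp [hlk, hl])
      · have he : e k = 1 := (hz _).resolve_left (left_ne_zero_of_mul hek)
        have hs : s k = 1 := (hz _).resolve_left (right_ne_zero_of_mul hek)
        obtain ⟨c, hc0, hX⟩ :=
          D.exists_X_mul_Xmon_eq_smul_update (k := k) (e := Function.update e k 0) (by simp)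
        rw [Function.update_idem, ← he, Function.update_eq_self] at hX
        have hmem := ih (Function.update e k 0)
          (funext fun l => by
            by_cases hl : l = k
            · subst hl; simp
            · simpa [Function.update_of_ne hl] using congrFun her l)
          (fun l hl => by
            by_cases hlk : l = k
            · subst hlk; simp
            · rw [Function.update_of_ne hlk]; exact hes l (by simp [hlk, hl]))
        obtain ⟨c', hc', hL⟩ := exists_Kmon_smul hμ hw.K_smul (D.u k)
        have h2 := N.smul_mem (D.X k) hmem
        rw [X_smul_tmul, hw.X_smul k hs, tmul_zero, zero_add, L, hL, smul_smul, hX, smul_assoc,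
          HopfTensor.tmul_smul, smul_tmul', smul_smul] at h2
        rw [← inv_smul_smul₀ (mul_ne_zero hc' hc0) (tmul D.Alg (D.Xmon e • v) w)]
        exact hc _ h2
  have h2 : ∀ x : V, tmul D.Alg x w ∈ N := fun x => by
    obtain ⟨h, rfl⟩ := hv' x
    have hx := hv.smul_mem_span_Xmon h
    generalize h • v = x at hx
    induction hx using Submodule.span_induction with
    | mem x hx =>
      obtain ⟨e, rfl⟩ := hx
      exact h1 Finset.univ e.1 e.2 (by simp)
    | zero => rw [zero_tmul]; exact N.zero_mem
    | add x x' _ _ hx hx' => rw [add_tmul]; exact N.add_mem hx hx'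
    | smul c x _ hx => rw [smul_tmul']; exact hc c hx
  let U : Submodule ℂ W :=
    { carrier := {y | ∀ x : V, tmul D.Alg x y ∈ N}
      zero_mem' := fun x => by rw [tmul_zero]; exact N.zero_mem
      add_mem' := fun hy hy' x => by rw [tmul_add]; exact N.add_mem (hy x) (hy' x)
      smul_mem' := fun c y hy x => by rw [HopfTensor.tmul_smul]; exact hc c (hy x) }
  have hUK : ∀ i, ∀ y ∈ U, D.K i • y ∈ U := fun i y hy x => by
    have := N.smul_mem (D.K i) (hy (D.K i ^ (D.m i - 1) • x))
    rwa [K_smul_tmul, K_smul_pow_pred_smul] at this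
  have hUL : ∀ k, ∀ y ∈ U, D.L k • y ∈ U := fun k => by
    have hpow : ∀ (i : Fin n) (j : ℕ), ∀ y ∈ U, D.K i ^ j • y ∈ U := fun i j => by
      induction j with
      | zero => exact fun y hy => by rwa [pow_zero, one_smul]
      | succ j ih => exact fun y hy => by rw [pow_succ, mul_smul]; exact ih _ (hUK i y hy)
    have key : ∀ {M : ℕ} (f : Fin M → D.Alg), (∀ i, ∀ y ∈ U, f i • y ∈ U) →
        ∀ y ∈ U, orderedProd f • y ∈ U := by
      intro M
      induction M with
      | zero => exact fun f _ y hy => by simpa [orderedProd] using hy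
      | succ M ih =>
        intro f h y hy
        rw [orderedProd_succ, mul_smul]
        exact h 0 _ (ih (fun i => f i.succ) (fun i => h i.succ) y hy)
    exact key _ fun i => hpow i _
  have hUX : ∀ k, ∀ y ∈ U, D.X k • y ∈ U := fun k y hy x => by
    have h3 := N.sub_mem (N.smul_mem (D.X k) (hy x)) (hUL k y hy (D.X k • x))
    rwa [X_smul_tmul, add_sub_cancel_right] at h3
  refine submodule_eq_top fun x y => ?_
  obtain ⟨h, rfl⟩ := hw' y
  exact smul_mem_of_generators hUK hUX h w h2 x

/-- The vectors `X ^ e v ⊗ w` with `e` avoiding `r` and `s` are singular of type `r * s`. -/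
theorem IsSingular.tmul {r s : Fin t → ZMod 2} {κ μ : Fin n → ℂ} {v : V} {w : W}
    (hv : D.IsSingular r κ v) (hw : D.IsSingular s μ w)
    (e : Fin t → ZMod 2) :
    D.IsSingular (r * s) (fun i => D.commScalar i e * κ i * μ i)
      (HopfTensor.tmul D.Alg (D.Xmon e • v) w) where
  K_smul i := by
    rw [K_smul_tmul, hv.K_smul_Xmon, hw.K_smul, smul_tmul', HopfTensor.tmul_smul, smul_smul]
  X_smul k hk := by
    have hrs : ∀ a b : ZMod 2, a * b = 1 → a = 1 ∧ b = 1 := by decide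
    obtain ⟨hr, hs⟩ := hrs _ _ hk
    rw [X_smul_tmul, hw.X_smul k hs, hv.X_smul_Xmon hr, tmul_zero, zero_tmul, add_zero]

end Tensor

/-! ### Counting dimensions -/

theorem card_subtype_forall_apply (P : Fin t → ZMod 2 → Prop) [∀ k, DecidablePred (P k)] :
    Fintype.card {e : Fin t → ZMod 2 // ∀ k, P k (e k)} =
      ∏ k, Fintype.card {z : ZMod 2 // P k z} := by
  rw [← Fintype.card_pi]
  exact Fintype.card_congr Equiv.subtypePiEquivPi

theorem card_Compl_mul_card_Compl (r s : Fin t → ZMod 2) :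
    Fintype.card (Sub (1 - (r + s) - r * s)) * Fintype.card (Compl (r * s)) =
      Fintype.card (Compl r) * Fintype.card (Compl s) := by
  have hC : ∀ r : Fin t → ZMod 2, Fintype.card (Compl r) =
      ∏ k, Fintype.card {z : ZMod 2 // z * r k = 0} := fun r => by
    rw [← card_subtype_forall_apply fun k z => z * r k = 0]
    exact Fintype.card_congr (Equiv.subtypeEquivRight fun e => funext_iff)
  have hS : ∀ o : Fin t → ZMod 2, Fintype.card (Sub o) =
      ∏ k, Fintype.card {z : ZMod 2 // z * o k = z} := fun o => by
    rw [← card_subtype_forall_apply fun k z => z * o k = z]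
    exact Fintype.card_congr (Equiv.subtypeEquivRight fun e => funext_iff)
  have h : ∀ a b : ZMod 2, Fintype.card {z : ZMod 2 // z * (1 - (a + b) - a * b) = z} *
      Fintype.card {z : ZMod 2 // z * (a * b) = 0} =
      Fintype.card {z : ZMod 2 // z * a = 0} * Fintype.card {z : ZMod 2 // z * b = 0} := by
    decide
  rw [hS, hC, hC, hC, ← Finset.prod_mul_distrib, ← Finset.prod_mul_distrib]
  exact Finset.prod_congr rfl fun k _ => h (r k) (s k)

theorem mul_compl_eq_self {r s e : Fin t → ZMod 2} (hr : e * r = 0) (hs : e * s = 0) :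
    e * (1 - (r + s) - r * s) = e := by
  rw [mul_sub, mul_sub, mul_add, ← mul_assoc, hr, hs, mul_one, add_zero, zero_mul, sub_zero,
    sub_zero]

variable (D)

/-- The map from the summand of `e` that sends its generator to `X ^ e (X ^ r ω_p) ⊗ X ^ s ω_q`. -/
theorem exists_hom_tensor (r s : Fin t → ZMod 2) (p q a b c : D.Wt)
    (ha : D.IsCommExp r a) (hb : D.IsCommExp s b) (hc : D.IsCommExp (r * s) c)
    {o : Fin t → ZMod 2} (e : Sub o) :
    ∃ f : D.V (r * s) (p + q - a - b + c - D.ell e) →ₗ[D.Alg]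
        HopfTensor D.Alg (D.V r p) (D.V s q),
      f (D.gen _ _) = HopfTensor.tmul D.Alg (D.Xmon e.1 • D.gen r p) (D.gen s q) := by
  have h := (D.isSingular_gen ha p).tmul (D.isSingular_gen hb q) e.1
  refine IsSingular.exists_hom hc _ ?_
  convert h using 2 with i
  -- The eigenvalues match because `c - (p + q - a - b + c - l) = l + (a - p) + (b - q)`.
  rw [← D.chi_ell, ← AddChar.map_add_eq_mul, ← AddChar.map_add_eq_mul]
  congr 1
  simp only [Pi.add_apply, Pi.sub_apply]
  ring

theorem finrank_tensor_eq {r s : Fin t → ZMod 2} {p q a b c : D.Wt}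
    (ha : D.IsCommExp r a) (hb : D.IsCommExp s b) (hc : D.IsCommExp (r * s) c)
    (l : Sub (1 - (r + s) - r * s) → D.Wt) :
    Module.finrank ℂ (⨁ e : Sub (1 - (r + s) - r * s), D.V (r * s) (l e)) =
      Module.finrank ℂ (HopfTensor D.Alg (D.V r p) (D.V s q)) := by
  have := D.finite_V ha p
  have := D.finite_V hb q
  have := fun x => D.finite_V hc x
  change _ = Module.finrank ℂ (D.V r p ⊗[ℂ] D.V s q)
  rw [Module.finrank_tensorProduct, Module.finrank_directSum, D.finrank_V ha, D.finrank_V hb,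
    ← card_Compl_mul_card_Compl]
  simp only [D.finrank_V hc, Finset.sum_const, Finset.card_univ, smul_eq_mul]

end NenciuData

theorem mainTheorem3 {n t : ℕ} (D : NenciuData n t) (r s : Fin t → ZMod 2) (p q a b c : D.Wt)
    (ha : D.IsCommExp r a) (hb : D.IsCommExp s b) (hc : D.IsCommExp (r * s) c) :
    Nonempty (HopfTensor D.Alg (D.V r p) (D.V s q) ≃ₗ[D.Alg]
      ⨁ e : NenciuData.Sub (1 - (r + s) - r * s),
        D.V (r * s) (p + q - a - b + c - D.ell e)) := by
  choose f hf using D.exists_hom_tensor r s p q a b c ha hb hc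
    (o := 1 - (r + s) - r * s)
  have := D.finite_V ha p
  have := D.finite_V hb q
  have := fun x => D.finite_V hc x
  have hfin : Module.Finite ℂ (HopfTensor D.Alg (D.V r p) (D.V s q)) :=
    inferInstanceAs (Module.Finite ℂ (D.V r p ⊗[ℂ] D.V s q))
  refine nonempty_linearEquiv_directSum f ?_ (D.finrank_tensor_eq ha hb hc _)
  refine NenciuData.eq_top_of_tmul_mem (fun i => D.chi_ne_zero i _) (D.isSingular_gen ha p)
    (D.isSingular_gen hb q) D.exists_smul_gen D.exists_smul_gen fun e hr hs => ?_
  exact Submodule.mem_iSup_of_mem ⟨e, NenciuData.mul_compl_eq_self hr hs⟩ ⟨_, hf _⟩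

end
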